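/- Let $B_n$ denote the Bernoulli numbers and $\zeta$ the Riemann zeta function. For an integer $k\ge 2$ put $$P_k(z)=\frac{(2\pi)^{2k-1}}{(2k)!}\sum_{j=0}^{k}(-1)^jB_{2j}B_{2k-2j}\binom{2k}{2j}z^{2j}+\zeta(2k-1)\left(z^{2k-1}+(-1)^kz\right)$$ and $$W_k(z)=\left(2^{2k-1}+2\right)P_k(z)-2^{2k}P_k(z/2)-P_k(2z).$$ Then, for every $k\ge 2$, $$W_k(z)=\frac{(2\pi)^{2k-1}2^{2k-1}}{(2k)!}\sum_{j=0}^{k}(-1)^jB_{2j}B_{2k-2j}\left(1-2^{1-2j}\right)\left(1-2^{1-2k+2j}\right)\binom{2k}{2j}z^{2j},$$ all complex zeros of $W_k$ lie on the unit circle $|z|=1$, and all of them are simple. -/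

import Mathlib

open Polynomial

/-- The polynomial
`P_k(z) = (2π)^(2k-1)/(2k)! ∑_{j=0}^k (-1)^j B_{2j} B_{2k-2j} (2k choose 2j) z^(2j)
  + ζ(2k-1) (z^(2k-1) + (-1)^k z)`, with complex coefficients (meant for `k ≥ 2`). -/
noncomputable def polyP (k : ℕ) : ℂ[X] :=
  C ((2 * (Real.pi : ℂ)) ^ (2 * k - 1) / (Nat.factorial (2 * k) : ℂ)) *
      ∑ j ∈ Finset.range (k + 1),
        C ((-1 : ℂ) ^ j * ((_root_.bernoulli (2 * j) : ℚ) : ℂ) * ((_root_.bernoulli (2 * k - 2 * j) : ℚ) : ℂ) *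
          (Nat.choose (2 * k) (2 * j) : ℂ)) * X ^ (2 * j)
    + C (riemannZeta (2 * (k : ℂ) - 1)) * (X ^ (2 * k - 1) + C ((-1 : ℂ) ^ k) * X)

/-- The polynomial `W_k(z) = (2^(2k-1) + 2) P_k(z) - 2^(2k) P_k(z/2) - P_k(2z)`. -/
noncomputable def polyW (k : ℕ) : ℂ[X] :=
  C ((2 : ℂ) ^ (2 * k - 1) + 2) * polyP k
    - C ((2 : ℂ) ^ (2 * k)) * (polyP k).comp (C (1 / 2 : ℂ) * X)
    - (polyP k).comp (C (2 : ℂ) * X)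

/-! The combination defining W_k cancels the odd-zeta terms. Euler's formula for ζ(2j) turns W_k(z)
into a nonzero constant times Q(-z²), where Q(w) = ∑ η(2j) η(2k-2j) w^j, η is the Dirichlet eta
function and η(0) = 1/2. Q is palindromic with coefficients increasing to the middle, so their total
variation is 2(h_mid - h_0). This is below 2h_0 = η(2k), because h_mid < η(2k)
(`sum_abs_sub_evenEta_mul_lt`). On the circle Q is a phase times a real cosine sum. Multiplied by 2
sin(θ/2), that sum becomes 2h_0 sin((k+1)θ/2) plus an error bounded by the variation. It therefore
changes sign k times in (0, 2π), which accounts for every zero of Q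
(`palindromic_roots_on_unit_circle`). -/

/-! ### Palindromic polynomials of small total variation -/

theorem sum_mul_sub_by_parts (h s : ℕ → ℝ) (k : ℕ) :
    ∑ j ∈ Finset.range (k + 1), h j * (s (j + 1) - s j) =
      h k * s (k + 1) - h 0 * s 0 - ∑ j ∈ Finset.range k, (h (j + 1) - h j) * s (j + 1) := by
  induction k with
  | zero => simp; ring
  | succ k ih => rw [Finset.sum_range_succ, ih, Finset.sum_range_succ _ k]; ring

theorem sum_abs_sub_of_palindromic_unimodal {h : ℕ → ℝ} {k : ℕ}
    (hsymm : ∀ j ≤ k, h (k - j) = h j) (hmono : ∀ j, 2 * j < k → h j ≤ h (j + 1)) :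
    ∑ j ∈ Finset.range k, |h (j + 1) - h j| = 2 * (h (k / 2) - h 0) := by
  -- The bound `k + 1` also admits the rounded-up half when `k` is odd.
  have tele : ∀ m, 2 * m ≤ k + 1 →
      ∑ j ∈ Finset.range m, |h (j + 1) - h j| = h m - h 0 := by
    intro m hm
    rw [← Finset.sum_range_sub]
    refine Finset.sum_congr rfl fun j hj => abs_of_nonneg ?_
    have := Finset.mem_range.1 hj
    linarith [hmono j (by omega)]
  obtain ⟨m, hm⟩ : ∃ m, m = k - k / 2 := ⟨_, rfl⟩
  have hk : k = k / 2 + m := by omega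
  have h2 : ∑ j ∈ Finset.range m, |h (k / 2 + j + 1) - h (k / 2 + j)| =
      ∑ j ∈ Finset.range m, |h (j + 1) - h j| := by
    rw [← Finset.sum_range_reflect]
    refine Finset.sum_congr rfl fun j hj => ?_
    have := Finset.mem_range.1 hj
    rw [abs_sub_comm, show k / 2 + (m - 1 - j) = k - (j + 1) by omega,
      show k - (j + 1) + 1 = k - j by omega, hsymm _ (by omega), hsymm _ (by omega)]
  have h3 : ∑ j ∈ Finset.range k, |h (j + 1) - h j| =
      ∑ j ∈ Finset.range (k / 2), |h (j + 1) - h j| +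
        ∑ j ∈ Finset.range m, |h (k / 2 + j + 1) - h (k / 2 + j)| := by
    conv_lhs => rw [hk]
    exact Finset.sum_range_add _ _ _
  rw [h3, h2, tele _ (by omega), tele _ (by omega), hm, hsymm _ (by omega)]
  ring

/-- The real trigonometric form of a palindromic polynomial on the unit circle. -/
theorem sum_mul_exp_pow_of_palindromic {h : ℕ → ℝ} {k : ℕ}
    (hsymm : ∀ j ≤ k, h (k - j) = h j) (θ : ℝ) :
    ∑ j ∈ Finset.range (k + 1), (h j : ℂ) * Complex.exp (θ * Complex.I) ^ j =
      Complex.exp (k / 2 * θ * Complex.I) *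
        ((∑ j ∈ Finset.range (k + 1), h j * Real.cos ((j - k / 2) * θ) : ℝ) : ℂ) := by
  -- The reflection j ↦ k - j fixes `h` and negates the sine.
  have hsin : ∑ j ∈ Finset.range (k + 1), h j * Real.sin ((j - k / 2) * θ) = 0 := by
    have := Finset.sum_range_reflect (fun j : ℕ => h j * Real.sin ((j - k / 2) * θ)) (k + 1)
    have h2 : ∑ j ∈ Finset.range (k + 1),
        h (k + 1 - 1 - j) * Real.sin (((k + 1 - 1 - j : ℕ) - (k : ℝ) / 2) * θ) =
        -∑ j ∈ Finset.range (k + 1), h j * Real.sin ((j - k / 2) * θ) := by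
      rw [← Finset.sum_neg_distrib]
      refine Finset.sum_congr rfl fun j hj => ?_
      have hj' : j ≤ k := Nat.lt_succ_iff.1 (Finset.mem_range.1 hj)
      rw [Nat.add_sub_cancel, hsymm j hj', Nat.cast_sub hj', ← mul_neg, ← Real.sin_neg]
      ring_nf
    linarith
  have hc : (((∑ j ∈ Finset.range (k + 1), h j * Real.cos ((j - k / 2) * θ) : ℝ)) : ℂ) =
      ∑ j ∈ Finset.range (k + 1), (h j : ℂ) * Complex.exp (((j - k / 2) * θ : ℝ) * Complex.I) := by
    have h0 : (((∑ j ∈ Finset.range (k + 1), h j * Real.sin ((j - k / 2) * θ) : ℝ)) : ℂ) = 0 := by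
      rw [hsin]; rfl
    rw [← add_zero (Complex.ofReal _), ← zero_mul Complex.I, ← h0]
    push_cast
    rw [Finset.sum_mul, ← Finset.sum_add_distrib]
    refine Finset.sum_congr rfl fun j _ => ?_
    rw [Complex.exp_mul_I]
    ring
  rw [hc, Finset.mul_sum]
  refine Finset.sum_congr rfl fun j _ => ?_
  rw [← Complex.exp_nat_mul, mul_left_comm (Complex.exp _), ← Complex.exp_add]
  push_cast
  ring_nf

/-- Each 2 sin(θ/2) cos((j - k/2)θ) is a difference of consecutive sines, so Abel summation applies.
-/
theorem two_mul_sin_mul_sum_cos (h : ℕ → ℝ) (k : ℕ) (θ : ℝ) :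
    2 * Real.sin (θ / 2) * ∑ j ∈ Finset.range (k + 1), h j * Real.cos ((j - k / 2) * θ) =
      h k * Real.sin ((k + 1) * θ / 2) + h 0 * Real.sin ((k + 1) * θ / 2) -
        ∑ j ∈ Finset.range k, (h (j + 1) - h j) * Real.sin ((j + 1 - (k + 1) / 2) * θ) := by
  have key := sum_mul_sub_by_parts h (fun j : ℕ => Real.sin ((j - (k + 1) / 2) * θ)) k
  have e0 : Real.sin (((0 : ℕ) - ((k : ℝ) + 1) / 2) * θ) = -Real.sin ((k + 1) * θ / 2) := by
    rw [← Real.sin_neg]; push_cast; ring_nf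
  have e1 : Real.sin (((k + 1 : ℕ) - ((k : ℝ) + 1) / 2) * θ) = Real.sin ((k + 1) * θ / 2) := by
    push_cast; ring_nf
  simp only [e0, e1] at key
  push_cast at key
  rw [mul_neg, sub_neg_eq_add] at key
  rw [← key, Finset.mul_sum]
  refine Finset.sum_congr rfl fun j _ => ?_
  rw [show ((j : ℝ) + 1 - (k + 1) / 2) * θ = (j - k / 2) * θ + θ / 2 by ring,
    show ((j : ℝ) - (k + 1) / 2) * θ = (j - k / 2) * θ - θ / 2 by ring,
    Real.sin_add, Real.sin_sub]
  ring

/-- At these angles sin((k+1)θ/2) = (-1)^m, so the boundary term has size 2h_0 and dominates the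
remaining sum; sin(θ/2) > 0 because m ≤ k. -/
theorem sign_sum_cos_at_extremal_angle {h : ℕ → ℝ} {k : ℕ} (hk : h k = h 0)
    (hvar : ∑ j ∈ Finset.range k, |h (j + 1) - h j| < 2 * h 0) {m : ℕ} (hm : m ≤ k) :
    0 < (-1) ^ m * ∑ j ∈ Finset.range (k + 1),
      h j * Real.cos ((j - k / 2) * ((2 * m + 1) * Real.pi / (k + 1))) := by
  set θ := (2 * (m : ℝ) + 1) * Real.pi / (k + 1) with hθ
  have hk1 : (0 : ℝ) < k + 1 := by positivity
  have hmk : (m : ℝ) ≤ k := by exact_mod_cast hm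
  have hs : 0 < Real.sin (θ / 2) := by
    apply Real.sin_pos_of_pos_of_lt_pi
    · positivity
    · rw [hθ, div_div, div_lt_iff₀ (by positivity)]
      nlinarith [Real.pi_pos]
  have hsn : Real.sin ((k + 1) * θ / 2) = (-1) ^ m := by
    rw [show (k + 1) * θ / 2 = Real.pi / 2 + m * Real.pi by rw [hθ]; field_simp; ring,
      Real.sin_add_nat_mul_pi, Real.sin_pi_div_two, mul_one]
  have key := two_mul_sin_mul_sum_cos h k θ
  rw [hsn, hk] at key
  have hb : |(-1) ^ m * ∑ j ∈ Finset.range k,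
      (h (j + 1) - h j) * Real.sin ((j + 1 - (k + 1) / 2) * θ)| ≤
      ∑ j ∈ Finset.range k, |h (j + 1) - h j| := by
    rw [abs_mul, abs_pow, abs_neg, abs_one, one_pow, one_mul]
    refine (Finset.abs_sum_le_sum_abs _ _).trans (Finset.sum_le_sum fun j _ => ?_)
    rw [abs_mul]
    exact mul_le_of_le_one_right (abs_nonneg _) (Real.abs_sin_le_one _)
  have hsq : ((-1 : ℝ) ^ m) * (-1) ^ m = 1 := by rw [← mul_pow]; norm_num
  refine pos_of_mul_pos_right (a := 2 * Real.sin (θ / 2)) ?_ (by positivity)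
  rw [mul_left_comm, key, mul_sub, ← two_mul,
    show (-1 : ℝ) ^ m * (2 * (h 0 * (-1) ^ m)) = 2 * h 0 * ((-1) ^ m * (-1) ^ m) by ring, hsq]
  linarith [(abs_le.1 hb).2]

theorem Polynomial.roots_eq_of_natDegree_le_card {R : Type*} [CommRing R] [IsDomain R]
    {p : R[X]} (hp : p ≠ 0) {s : Finset R} (hs : ∀ x ∈ s, p.IsRoot x)
    (hcard : p.natDegree ≤ s.card) : p.roots = s.val := by
  refine (Multiset.eq_of_le_of_card_le ?_ (p.card_roots'.trans hcard)).symm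
  rw [Multiset.le_iff_subset s.nodup]
  exact fun x hx => (mem_roots hp).2 (hs x hx)

/-- A palindromic real polynomial whose coefficients have total variation less than twice the
constant coefficient has only simple zeros, all of them on the unit circle. -/
theorem palindromic_roots_on_unit_circle {h : ℕ → ℝ} {k : ℕ}
    (hsymm : ∀ j ≤ k, h (k - j) = h j)
    (hvar : ∑ j ∈ Finset.range k, |h (j + 1) - h j| < 2 * h 0) {w : ℂ}
    (hw : (∑ j ∈ Finset.range (k + 1), C (h j : ℂ) * X ^ j : ℂ[X]).IsRoot w) :
    ‖w‖ = 1 ∧ (derivative (∑ j ∈ Finset.range (k + 1), C (h j : ℂ) * X ^ j : ℂ[X])).eval w ≠ 0 := by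
  set p : ℂ[X] := ∑ j ∈ Finset.range (k + 1), C (h j : ℂ) * X ^ j with hpdef
  have hk0 : h k = h 0 := by simpa using hsymm 0 (Nat.zero_le _)
  have hh0 : 0 < h 0 := by
    have := Finset.sum_nonneg (s := Finset.range k) (fun j _ => abs_nonneg (h (j + 1) - h j))
    linarith
  have hcoeff : p.coeff 0 = h 0 := by
    simp [hpdef, coeff_X_pow]
  have hp0 : p ≠ 0 := by
    intro hp
    rw [hp, coeff_zero] at hcoeff
    exact hh0.ne (by exact_mod_cast hcoeff)
  have hdeg : p.natDegree ≤ k := by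
    refine natDegree_sum_le_of_forall_le _ _ fun j hj => ?_
    exact (natDegree_C_mul_X_pow_le _ _).trans (Nat.lt_succ_iff.1 (Finset.mem_range.1 hj))
  set R : ℝ → ℝ := fun θ => ∑ j ∈ Finset.range (k + 1), h j * Real.cos ((j - k / 2) * θ) with hR
  have hRc : Continuous R := by fun_prop
  set t : ℕ → ℝ := fun m => (2 * (m : ℝ) + 1) * Real.pi / (k + 1) with ht
  have hk1 : (0 : ℝ) < k + 1 := by positivity
  have htmono : StrictMono t := by
    refine strictMono_nat_of_lt_succ fun m => ?_
    simp only [ht]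
    gcongr
    simp
  -- The k + 1 alternating signs give k zeros in disjoint intervals.
  have hzero : ∀ m : Fin k, ∃ θ ∈ Set.Ioo (t m) (t (m + 1)), R θ = 0 := by
    intro m
    have h1 := sign_sum_cos_at_extremal_angle hk0 hvar m.2.le
    have h2 := sign_sum_cos_at_extremal_angle hk0 hvar (Nat.succ_le_of_lt m.2)
    change 0 < (-1) ^ (m : ℕ) * R (t m) at h1
    change 0 < (-1) ^ (m + 1 : ℕ) * R (t (m + 1)) at h2
    rw [pow_succ] at h2
    have hle : t m ≤ t (m + 1) := (htmono (Nat.lt_succ_self _)).le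
    rcases neg_one_pow_eq_or ℝ (m : ℕ) with e | e <;> rw [e] at h1 h2
    · exact intermediate_value_Ioo' hle hRc.continuousOn ⟨by linarith, by linarith⟩
    · exact intermediate_value_Ioo hle hRc.continuousOn ⟨by linarith, by linarith⟩
  choose θ hθ hRθ using hzero
  have hθmono : StrictMono θ := by
    intro a b hab
    exact ((hθ a).2.trans_le (htmono.monotone (Nat.succ_le_of_lt hab))).trans (hθ b).1
  have hθpos : ∀ m, 0 < θ m := fun m =>
    lt_trans (by simp only [ht]; positivity) (hθ m).1
  have hθlt : ∀ m, θ m < 2 * Real.pi := by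
    intro m
    refine ((hθ m).2.trans_le (htmono.monotone (Nat.succ_le_of_lt m.2))).trans ?_
    simp only [ht]
    rw [div_lt_iff₀ hk1]
    nlinarith [Real.pi_pos]
  let z : Fin k → ℂ := fun m => Complex.exp (θ m * Complex.I)
  have hz : Function.Injective z := by
    intro a b hab
    have : Circle.exp (θ a) = Circle.exp (θ b) := Circle.ext (by simpa [Circle.coe_exp] using hab)
    exact hθmono.injective (Circle.exp_injOn_Ico (a := 0) (b := 2 * Real.pi) (by simp)
      ⟨(hθpos a).le, hθlt a⟩ ⟨(hθpos b).le, hθlt b⟩ this)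
  have hroots : p.roots = (Finset.univ.image z).val := by
    refine roots_eq_of_natDegree_le_card hp0 ?_ ?_
    · intro x hx
      obtain ⟨m, -, rfl⟩ := Finset.mem_image.1 hx
      have := sum_mul_exp_pow_of_palindromic hsymm (θ m)
      rw [show (∑ j ∈ Finset.range (k + 1), h j * Real.cos ((j - k / 2) * θ m)) = 0 from hRθ m] at this
      simpa [hpdef, eval_finsetSum, z, IsRoot.def] using this
    · rw [Finset.card_image_of_injective _ hz]
      simpa using hdeg
  have hmem : w ∈ p.roots := (mem_roots hp0).2 hw
  refine ⟨?_, ?_⟩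
  · rw [hroots, Finset.mem_val] at hmem
    obtain ⟨m, -, rfl⟩ := Finset.mem_image.1 hmem
    exact Complex.norm_exp_ofReal_mul_I _
  · intro hd
    have h1 : 1 < p.rootMultiplicity w := (one_lt_rootMultiplicity_iff_isRoot hp0).2 ⟨hw, hd⟩
    rw [← count_roots, hroots] at h1
    exact absurd (Multiset.nodup_iff_count_le_one.1 (Finset.nodup _) w) (not_le.2 h1)

/-! ### Eta values at even integers -/

/-- The value `(1 - 2^(1-2j)) ζ(2j)` of the Dirichlet eta function at `2j`, in terms of
Bernoulli numbers. -/
noncomputable def evenEta (j : ℕ) : ℝ :=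
  (-1) ^ (j + 1) * (4 ^ j / 2 - 1) * Real.pi ^ (2 * j) * (_root_.bernoulli (2 * j) : ℚ) /
    (Nat.factorial (2 * j) : ℝ)

theorem evenEta_zero : evenEta 0 = 1 / 2 := by
  norm_num [evenEta]

/-- The even terms sum to ζ(2j)/4^j = η(2j)/(4^j - 2), and the odd terms are the rest of ζ(2j). -/
theorem hasSum_odd_even_evenEta {j : ℕ} (hj : j ≠ 0) :
    HasSum (fun n : ℕ => 1 / ((2 * n + 1 : ℕ) : ℝ) ^ (2 * j)) (evenEta j + (evenEta j) / (4 ^ j - 2)) ∧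
    HasSum (fun n : ℕ => 1 / ((2 * n : ℕ) : ℝ) ^ (2 * j)) (evenEta j / (4 ^ j - 2)) := by
  have h4 : (4 : ℝ) ≤ 4 ^ j := le_self_pow₀ (by norm_num) hj
  have h2 : (4 : ℝ) ^ j - 2 ≠ 0 := by linarith
  have hz := hasSum_zeta_nat hj
  have hval : (-1 : ℝ) ^ (j + 1) * (2 : ℝ) ^ (2 * j - 1) * Real.pi ^ (2 * j) *
        (_root_.bernoulli (2 * j) : ℚ) / (Nat.factorial (2 * j) : ℝ) =
      4 ^ j * (evenEta j / (4 ^ j - 2)) := by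
    have : (2 : ℝ) ^ (2 * j - 1) = 4 ^ j / 2 := by
      rw [pow_sub₀ _ two_ne_zero (by omega), pow_mul]; norm_num; ring
    rw [this, evenEta]
    field_simp
  rw [hval] at hz
  have he : HasSum (fun n : ℕ => 1 / ((2 * n : ℕ) : ℝ) ^ (2 * j)) (evenEta j / (4 ^ j - 2)) := by
    have := hz.mul_left (1 / (4 : ℝ) ^ j)
    rw [← mul_assoc, one_div_mul_cancel (by positivity), one_mul] at this
    convert! this using 2 with n
    push_cast
    rw [mul_pow, pow_mul 2 2 j, one_div_mul_one_div]
    norm_num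
  refine ⟨?_, he⟩
  have ho := (hz.summable.comp_injective
    (show Function.Injective (fun n : ℕ => 2 * n + 1) from fun a b h => by
      simpa using h)).hasSum
  have huniq := (HasSum.even_add_odd (f := fun n : ℕ => 1 / (n : ℝ) ^ (2 * j)) he ho).unique hz
  convert! ho using 1
  rw [← sub_eq_iff_eq_add'.2 huniq.symm]
  field_simp
  ring

theorem hasSum_evenEta {j : ℕ} (hj : j ≠ 0) :
    HasSum (fun n : ℕ => 1 / (2 * (n : ℝ) + 1) ^ (2 * j) - 1 / (2 * (n : ℝ) + 2) ^ (2 * j))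
      (evenEta j) := by
  obtain ⟨ho, he⟩ := hasSum_odd_even_evenEta hj
  -- The dropped term n = 0 is 1/0, which is 0 by convention.
  have he' := (hasSum_nat_add_iff' 1).2 he
  have := ho.sub he'
  convert! this using 1
  · ext n; push_cast; ring_nf
  · simp [hj]

theorem hasSum_one_sub_evenEta {j : ℕ} (hj : j ≠ 0) :
    HasSum (fun n : ℕ => 1 / (2 * (n : ℝ) + 2) ^ (2 * j) - 1 / (2 * (n : ℝ) + 3) ^ (2 * j))
      (1 - evenEta j) := by
  obtain ⟨ho, he⟩ := hasSum_odd_even_evenEta hj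
  have he' := (hasSum_nat_add_iff' 1).2 he
  have ho' := (hasSum_nat_add_iff' 1).2 ho
  have := he'.sub ho'
  convert! this using 1
  · ext n; push_cast; ring_nf
  · simp [hj]
    ring

theorem one_sub_inv_four_pow_le_evenEta {j : ℕ} (hj : j ≠ 0) :
    1 - (1 / 4 : ℝ) ^ j ≤ evenEta j := by
  have := le_hasSum (hasSum_evenEta hj) 0 fun n _ => by
    rw [sub_nonneg]
    gcongr
    norm_num
  refine le_trans (le_of_eq ?_) this
  simp [pow_mul]
  norm_num

theorem evenEta_le {j : ℕ} (hj : j ≠ 0) :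
    evenEta j ≤ 1 - (1 / 4 : ℝ) ^ j + (1 / 9) ^ j := by
  have := le_hasSum (hasSum_one_sub_evenEta hj) 0 fun n _ => by
    rw [sub_nonneg]
    gcongr
    norm_num
  simp only [Nat.cast_zero, mul_zero, zero_add, pow_mul] at this
  norm_num at this
  rw [one_div_pow, one_div_pow, one_div, one_div]
  linarith

theorem evenEta_pos (j : ℕ) : 0 < evenEta j := by
  rcases eq_or_ne j 0 with rfl | hj
  · rw [evenEta_zero]; norm_num
  · refine lt_of_lt_of_le ?_ (one_sub_inv_four_pow_le_evenEta hj)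
    exact sub_pos.2 (pow_lt_one₀ (by norm_num) (by norm_num) hj)

theorem evenEta_lt_one (j : ℕ) : evenEta j < 1 := by
  rcases eq_or_ne j 0 with rfl | hj
  · rw [evenEta_zero]; norm_num
  · have : (1 / 9 : ℝ) ^ j < (1 / 4) ^ j := pow_lt_pow_left₀ (by norm_num) (by norm_num) hj
    linarith [evenEta_le hj]

theorem evenEta_monotone : Monotone evenEta := by
  refine monotone_nat_of_le_succ fun j => ?_
  have h1 := one_sub_inv_four_pow_le_evenEta j.succ_ne_zero
  rcases eq_or_ne j 0 with rfl | hj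
  · rw [evenEta_zero]; norm_num at h1 ⊢; linarith
  · refine (evenEta_le hj).trans (le_trans ?_ h1)
    have h2 : (4 / 9 : ℝ) ^ j ≤ 4 / 9 := pow_le_of_le_one (by norm_num) (by norm_num) hj
    have h3 : (1 / 9 : ℝ) ^ j = (1 / 4) ^ j * (4 / 9) ^ j := by rw [← mul_pow]; norm_num
    have h4 : (0 : ℝ) < (1 / 4) ^ j := by positivity
    rw [h3, pow_succ]
    nlinarith

/-- For j ≥ 1, (1 - 4^(-j)/4)² ≥ 1 - 4^(-j)/2, while η(2j) ≤ 1 - (5/9)4^(-j). For j = 0, 1/2 ≤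
(3/4)². -/
theorem evenEta_le_sq_succ (j : ℕ) : evenEta j ≤ evenEta (j + 1) ^ 2 := by
  have h1 := one_sub_inv_four_pow_le_evenEta j.succ_ne_zero
  rcases eq_or_ne j 0 with rfl | hj
  · rw [evenEta_zero]; norm_num at h1 ⊢; nlinarith
  · have h5 : (1 / 4 : ℝ) ^ j ≤ 1 / 4 := pow_le_of_le_one (by norm_num) (by norm_num) hj
    have h2 : (4 / 9 : ℝ) ^ j ≤ 4 / 9 := pow_le_of_le_one (by norm_num) (by norm_num) hj
    have h3 : (1 / 9 : ℝ) ^ j = (1 / 4) ^ j * (4 / 9) ^ j := by rw [← mul_pow]; norm_num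
    have h4 : (0 : ℝ) < (1 / 4) ^ j := by positivity
    refine (evenEta_le hj).trans ?_
    rw [h3]
    rw [Nat.succ_eq_add_one, pow_succ] at h1
    nlinarith

/-- The products `η(2j) η(2k-2j)` increase with `j` up to the middle. -/
theorem evenEta_mul_le_mul {k j : ℕ} (hj : 2 * j < k) :
    evenEta j * evenEta (k - j) ≤ evenEta (j + 1) * evenEta (k - (j + 1)) := by
  obtain ⟨m, rfl⟩ : ∃ m, k = j + m + 1 := ⟨k - j - 1, by omega⟩
  rw [show j + m + 1 - j = m + 1 by omega, show j + m + 1 - (j + 1) = m by omega]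
  rcases (show j ≤ m by omega).eq_or_lt with rfl | hjm
  -- For j = m the step straddles the middle and both products agree.
  · rw [mul_comm]
  · calc evenEta j * evenEta (m + 1) ≤ evenEta j :=
          mul_le_of_le_one_right (evenEta_pos j).le (evenEta_lt_one _).le
      _ ≤ evenEta (j + 1) * evenEta (j + 1) := by rw [← sq]; exact evenEta_le_sq_succ j
      _ ≤ evenEta (j + 1) * evenEta m :=
          mul_le_mul_of_nonneg_left (evenEta_monotone hjm) (evenEta_pos _).le

theorem evenEta_mul_symm {k j : ℕ} (hj : j ≤ k) :
    evenEta (k - j) * evenEta (k - (k - j)) = evenEta j * evenEta (k - j) := by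
  rw [Nat.sub_sub_self hj, mul_comm]

theorem sum_abs_sub_evenEta_mul_lt (k : ℕ) :
    ∑ j ∈ Finset.range k,
        |evenEta (j + 1) * evenEta (k - (j + 1)) - evenEta j * evenEta (k - j)| <
      2 * (evenEta 0 * evenEta (k - 0)) := by
  rw [sum_abs_sub_of_palindromic_unimodal (h := fun j => evenEta j * evenEta (k - j))
    (fun j hj => evenEta_mul_symm hj) (fun j hj => evenEta_mul_le_mul hj)]
  have h1 : evenEta (k / 2) * evenEta (k - k / 2) < evenEta k :=
    (mul_lt_of_lt_one_left (evenEta_pos _) (evenEta_lt_one _)).trans_le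
      (evenEta_monotone (Nat.sub_le _ _))
  rw [evenEta_zero, Nat.sub_zero]
  linarith

/-! ### From Bernoulli numbers to eta values -/

theorem polyW_coefficient (k j : ℕ) (hj : j ≤ k) (hk : 1 ≤ k) :
    (2 * (Real.pi : ℂ)) ^ (2 * k - 1) * (2 : ℂ) ^ (2 * k - 1) / (Nat.factorial (2 * k) : ℂ) *
      ((-1 : ℂ) ^ j * ((_root_.bernoulli (2 * j) : ℚ) : ℂ) *
        ((_root_.bernoulli (2 * k - 2 * j) : ℚ) : ℂ) *
        (1 - (2 : ℂ) ^ (1 - 2 * (j : ℤ))) * (1 - (2 : ℂ) ^ (1 - 2 * (k : ℤ) + 2 * (j : ℤ))) *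
        (Nat.choose (2 * k) (2 * j) : ℂ)) =
      (-1) ^ k * 4 ^ k / Real.pi * (((evenEta j * evenEta (k - j) : ℝ) : ℂ) * (-1) ^ j) := by
  obtain ⟨m, rfl⟩ := Nat.exists_eq_add_of_le hj
  have hpi : (Real.pi : ℂ) ≠ 0 := by exact_mod_cast Real.pi_ne_zero
  have hpow : ∀ i : ℕ, (2 : ℂ) ^ (1 - 2 * (i : ℤ)) = 2 / 4 ^ i := by
    intro i
    rw [zpow_sub₀ two_ne_zero, zpow_one, zpow_mul, zpow_natCast]
    norm_num
  rw [show 1 - 2 * ((j + m : ℕ) : ℤ) + 2 * (j : ℤ) = 1 - 2 * (m : ℤ) by push_cast; ring,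
    hpow, hpow, show 2 * (j + m) - 2 * j = 2 * m by omega, Nat.add_sub_cancel_left,
    Nat.cast_choose ℂ (show 2 * j ≤ 2 * (j + m) by omega),
    show 2 * (j + m) - 2 * j = 2 * m by omega, mul_pow,
    pow_sub₀ (2 : ℂ) two_ne_zero (show 1 ≤ 2 * (j + m) by omega),
    pow_sub₀ (Real.pi : ℂ) hpi (show 1 ≤ 2 * (j + m) by omega)]
  have hf : ∀ i : ℕ, (Nat.factorial i : ℂ) ≠ 0 := fun i => by
    exact_mod_cast Nat.factorial_ne_zero i
  have h2 : (2 : ℂ) ^ (2 * (j + m)) = 4 ^ j * 4 ^ m := by rw [pow_mul, pow_add]; norm_num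
  have hs : ((-1 : ℂ) ^ m) * (-1) ^ m = 1 := by rw [← mul_pow]; norm_num
  have hs' : ((-1 : ℂ) ^ j) * (-1) ^ j = 1 := by rw [← mul_pow]; norm_num
  have h4 : ∀ i : ℕ, (4 : ℂ) ^ i ≠ 0 := fun i => pow_ne_zero _ (by norm_num)
  simp only [evenEta]
  push_cast
  rw [h2, mul_add, pow_add (Real.pi : ℂ), pow_add (-1 : ℂ) j m, pow_succ (-1 : ℂ) j,
    pow_succ (-1 : ℂ) m, pow_add (4 : ℂ)]
  rcases neg_one_pow_eq_or ℂ j with e | e <;> rcases neg_one_pow_eq_or ℂ m with e' | e' <;>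
    (rw [e, e']; field_simp [hf, h4])

theorem polyW_eq (k : ℕ) (hk : 2 ≤ k) :
    polyW k =
      C ((2 * (Real.pi : ℂ)) ^ (2 * k - 1) * (2 : ℂ) ^ (2 * k - 1) /
          (Nat.factorial (2 * k) : ℂ)) *
        ∑ j ∈ Finset.range (k + 1),
          C ((-1 : ℂ) ^ j * ((_root_.bernoulli (2 * j) : ℚ) : ℂ) *
            ((_root_.bernoulli (2 * k - 2 * j) : ℚ) : ℂ) *
            (1 - (2 : ℂ) ^ (1 - 2 * (j : ℤ))) *
            (1 - (2 : ℂ) ^ (1 - 2 * (k : ℤ) + 2 * (j : ℤ))) *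
            (Nat.choose (2 * k) (2 * j) : ℂ)) * X ^ (2 * j) := by
  refine Polynomial.funext fun z => ?_
  obtain ⟨n, hn⟩ : ∃ n, 2 * k = n + 1 := ⟨2 * k - 1, by omega⟩
  have h2n : (2 : ℂ) ^ n ≠ 0 := pow_ne_zero _ two_ne_zero
  simp only [polyW, polyP, eval_sub, eval_mul, eval_add, eval_C, eval_comp, eval_X, eval_pow,
    eval_finsetSum]
  -- The weights of W_k are chosen to annihilate both z and z^(2k-1).
  have hodd : ((2 : ℂ) ^ (2 * k - 1) + 2) * (z ^ (2 * k - 1) + (-1) ^ k * z) -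
      2 ^ (2 * k) * ((1 / 2 * z) ^ (2 * k - 1) + (-1) ^ k * (1 / 2 * z)) -
      ((2 * z) ^ (2 * k - 1) + (-1) ^ k * (2 * z)) = 0 := by
    rw [hn, Nat.add_sub_cancel, mul_pow, mul_pow, one_div_pow]
    field_simp
    ring
  -- On z^(2j) they act by 2^(2k-1) + 2 - 2^(2k-2j) - 2^(2j), which factors.
  have heven : ∀ c : ℕ → ℂ, ((2 : ℂ) ^ (2 * k - 1) + 2) *
        ∑ j ∈ Finset.range (k + 1), c j * z ^ (2 * j) -
      2 ^ (2 * k) * ∑ j ∈ Finset.range (k + 1), c j * (1 / 2 * z) ^ (2 * j) -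
      ∑ j ∈ Finset.range (k + 1), c j * (2 * z) ^ (2 * j) =
      2 ^ (2 * k - 1) * ∑ j ∈ Finset.range (k + 1), c j * ((1 - (2 : ℂ) ^ (1 - 2 * (j : ℤ))) *
        (1 - (2 : ℂ) ^ (1 - 2 * (k : ℤ) + 2 * (j : ℤ)))) * z ^ (2 * j) := by
    intro c
    simp only [Finset.mul_sum, ← Finset.sum_sub_distrib]
    refine Finset.sum_congr rfl fun j _ => ?_
    have h4j : (4 : ℂ) ^ j ≠ 0 := pow_ne_zero _ (by norm_num)
    have h4k : (4 : ℂ) ^ k ≠ 0 := pow_ne_zero _ (by norm_num)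
    have e1 : (2 : ℂ) ^ (1 - 2 * (j : ℤ)) = 2 / 4 ^ j := by
      rw [zpow_sub₀ two_ne_zero, zpow_one, zpow_mul, zpow_natCast]
      norm_num
    have e2 : (2 : ℂ) ^ (1 - 2 * (k : ℤ) + 2 * (j : ℤ)) = 2 / 4 ^ k * 4 ^ j := by
      rw [zpow_add₀ two_ne_zero, zpow_sub₀ two_ne_zero, zpow_one, zpow_mul, zpow_mul,
        zpow_natCast, zpow_natCast]
      norm_num
    have e3 : (2 : ℂ) ^ (2 * k - 1) = 4 ^ k / 2 := by
      rw [pow_sub₀ _ two_ne_zero (by omega), pow_mul]; norm_num; ring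
    have e4 : ∀ i : ℕ, (2 : ℂ) ^ (2 * i) = 4 ^ i := fun i => by rw [pow_mul]; norm_num
    rw [e1, e2, e3, mul_pow, mul_pow, one_div_pow, e4, e4]
    field_simp
    ring
  have he := heven fun j => (-1 : ℂ) ^ j * ((_root_.bernoulli (2 * j) : ℚ) : ℂ) *
    ((_root_.bernoulli (2 * k - 2 * j) : ℚ) : ℂ) * (Nat.choose (2 * k) (2 * j) : ℂ)
  rw [mul_div_right_comm, mul_assoc]
  have hr : ∀ j : ℕ, (-1 : ℂ) ^ j * ((_root_.bernoulli (2 * j) : ℚ) : ℂ) *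
      ((_root_.bernoulli (2 * k - 2 * j) : ℚ) : ℂ) * (1 - (2 : ℂ) ^ (1 - 2 * (j : ℤ))) *
      (1 - (2 : ℂ) ^ (1 - 2 * (k : ℤ) + 2 * (j : ℤ))) * (Nat.choose (2 * k) (2 * j) : ℂ) =
      (-1 : ℂ) ^ j * ((_root_.bernoulli (2 * j) : ℚ) : ℂ) *
      ((_root_.bernoulli (2 * k - 2 * j) : ℚ) : ℂ) * (Nat.choose (2 * k) (2 * j) : ℂ) *
      ((1 - (2 : ℂ) ^ (1 - 2 * (j : ℤ))) *
        (1 - (2 : ℂ) ^ (1 - 2 * (k : ℤ) + 2 * (j : ℤ)))) := fun j => by ring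
  simp only [hr]
  rw [← he]
  linear_combination (riemannZeta (2 * (k : ℂ) - 1)) * hodd

theorem polyW_eq_comp (k : ℕ) (hk : 2 ≤ k) :
    polyW k = C ((-1) ^ k * 4 ^ k / (Real.pi : ℂ)) *
      (∑ j ∈ Finset.range (k + 1),
        C ((evenEta j * evenEta (k - j) : ℝ) : ℂ) * X ^ j : ℂ[X]).comp (-X ^ 2) := by
  rw [polyW_eq k hk, Finset.mul_sum, Polynomial.sum_comp, Finset.mul_sum]
  refine Finset.sum_congr rfl fun j hj => ?_
  rw [← mul_assoc, ← C_mul, polyW_coefficient k j (Nat.lt_succ_iff.1 (Finset.mem_range.1 hj))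
    (by omega)]
  simp only [mul_comp, C_comp, pow_comp, X_comp, C_mul, C_pow, C_neg, C_1]
  rw [neg_pow (X ^ 2 : ℂ[X]) j, ← pow_mul]
  ring

theorem theorem3 (k : ℕ) (hk : 2 ≤ k) :
    polyW k =
      C ((2 * (Real.pi : ℂ)) ^ (2 * k - 1) * (2 : ℂ) ^ (2 * k - 1) /
          (Nat.factorial (2 * k) : ℂ)) *
        ∑ j ∈ Finset.range (k + 1),
          C ((-1 : ℂ) ^ j * ((_root_.bernoulli (2 * j) : ℚ) : ℂ) *
            ((_root_.bernoulli (2 * k - 2 * j) : ℚ) : ℂ) *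
            (1 - (2 : ℂ) ^ (1 - 2 * (j : ℤ))) *
            (1 - (2 : ℂ) ^ (1 - 2 * (k : ℤ) + 2 * (j : ℤ))) *
            (Nat.choose (2 * k) (2 * j) : ℂ)) * X ^ (2 * j) ∧
    (∀ z : ℂ, (polyW k).IsRoot z → ‖z‖ = 1) ∧
    (∀ z : ℂ, (polyW k).IsRoot z → (polyW k).rootMultiplicity z = 1) := by
  have key : ∀ z : ℂ, (polyW k).IsRoot z → ‖z‖ = 1 ∧ (derivative (polyW k)).eval z ≠ 0 := by
    intro z hz
    have hc : (-1) ^ k * 4 ^ k / (Real.pi : ℂ) ≠ 0 := by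
      have hpi : (Real.pi : ℂ) ≠ 0 := by exact_mod_cast Real.pi_ne_zero
      exact div_ne_zero (mul_ne_zero (pow_ne_zero _ (by norm_num)) (pow_ne_zero _ (by norm_num)))
        hpi
    rw [polyW_eq_comp k hk] at hz ⊢
    have hw : (∑ j ∈ Finset.range (k + 1),
        C ((evenEta j * evenEta (k - j) : ℝ) : ℂ) * X ^ j : ℂ[X]).IsRoot (-z ^ 2) := by
      rw [IsRoot.def, eval_mul, eval_C, eval_comp] at hz
      simpa using (mul_eq_zero.1 hz).resolve_left hc
    obtain ⟨h1, h2⟩ := palindromic_roots_on_unit_circle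
      (h := fun j => evenEta j * evenEta (k - j)) (fun j hj => evenEta_mul_symm hj)
      (sum_abs_sub_evenEta_mul_lt k) hw
    rw [norm_neg, norm_pow, pow_eq_one_iff_of_nonneg (norm_nonneg z) two_ne_zero] at h1
    have hz0 : z ≠ 0 := by
      rintro rfl
      simp at h1
    refine ⟨h1, ?_⟩
    -- By the chain rule, simplicity passes from Q to W_k because -2z ≠ 0.
    rw [derivative_C_mul, derivative_comp, eval_mul, eval_C, eval_mul, eval_comp]
    refine mul_ne_zero hc (mul_ne_zero ?_ ?_)
    · simpa using hz0
    · rwa [show eval z (-X ^ 2 : ℂ[X]) = -z ^ 2 by simp]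
  refine ⟨polyW_eq k hk, fun z hz => (key z hz).1, fun z hz => ?_⟩
  have h0 : polyW k ≠ 0 := fun h => (key z hz).2 (by simp [h])
  have h1 : 0 < (polyW k).rootMultiplicity z := (rootMultiplicity_pos h0).2 hz
  have h2 : ¬1 < (polyW k).rootMultiplicity z := fun h =>
    (key z hz).2 ((one_lt_rootMultiplicity_iff_isRoot h0).1 h).2
  omega
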